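/- Let $R$ be an associative ring with identity; all modules are unital $R$-modules on one fixed side. For modules $Q,N$: $Q$ is $N$-injective if every homomorphism from a submodule of $N$ to $Q$ extends to $N$; $Q$ is $N$-projective if every homomorphism from $Q$ to a factor module $N/K$ lifts to $N$ along $N\to N/K$; and $Q$ is almost $N$-injective if for every submodule $N'\subseteq N$ and every homomorphism $f:N'\to Q$, either $f$ extends to a homomorphism $N\to Q$, or there are a nonzero idempotent $\pi\in\operatorname{End}_R(N)$ and a homomorphism $h:Q\to\pi(N)$ with $hf=\pi|_{N'}$. For a module $M$, let $\sigma(M)$ be the full subcategory of the category of $R$-modules consisting of all modules subgenerated by $M$, i.e. isomorphic to a submodule of a factor module of a direct sum of copies of $M$, and let $J(M)$ be the Jacobson radical of $M$ (the intersection of all maximal submodules of $M$, equal to $M$ if there are none). A module $N$ is a $V$-module if every simple module is $N$-injective. A module $M$ is an almost $V$-module if every simple module is almost $N$-injective for every $N\in\sigma(M)$. A module is local if it has a largest proper submodule. **Theorem.** For every module $M$ the following are equivalent: 1. $M$ is an almost $V$-module. 2. Every module in $\sigma(M)$ is a $V$-module or has a nonzero direct summand that is a projective object of the category $\sigma(M)$.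 3. There is an independent family $\{A_i\}_{i\in I}$ (possibly empty) of local submodules of $M$ such that (a) every $A_i$ is $M$-injective, $M$-projective and of length two; (b) $J(M)=\bigoplus_{i\in I}J(A_i)$; (c) $M/J(M)$ is a $V$-module. -/

import Mathlib

universe u v w

/-! Modules are left modules over an arbitrary (not necessarily commutative) ring; right modules
over a ring are left modules over its opposite. -/

/-- `Q` is `N`-injective: every homomorphism from a submodule of `N` to `Q` extends to `N`. -/
def IsRelInjective (R : Type u) [Ring R] (Q : Type v) [AddCommGroup Q] [Module R Q]
    (N : Type w) [AddCommGroup N] [Module R N] : Prop :=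
  ∀ (N' : Submodule R N) (f : N' →ₗ[R] Q), ∃ g : N →ₗ[R] Q, g ∘ₗ N'.subtype = f

/-- `P` is `N`-projective: every homomorphism from `P` to a factor module of `N` lifts to `N`. -/
def IsRelProjective (R : Type u) [Ring R] (P : Type v) [AddCommGroup P] [Module R P]
    (N : Type w) [AddCommGroup N] [Module R N] : Prop :=
  ∀ (K : Submodule R N) (f : P →ₗ[R] N ⧸ K), ∃ h : P →ₗ[R] N, K.mkQ ∘ₗ h = f

/-- `Q` is almost `N`-injective: for every submodule `N'` of `N` and every `f : N' → Q`, either `f`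
extends to `N`, or there are a nonzero idempotent endomorphism `π` of `N` and a homomorphism
`h : Q → π(N)` such that `h ∘ f` is the restriction of `π` to `N'`. -/
def IsAlmostRelInjective (R : Type u) [Ring R] (Q : Type v) [AddCommGroup Q] [Module R Q]
    (N : Type w) [AddCommGroup N] [Module R N] : Prop :=
  ∀ (N' : Submodule R N) (f : N' →ₗ[R] Q),
    (∃ g : N →ₗ[R] Q, g ∘ₗ N'.subtype = f) ∨
    (∃ (π : Module.End R N) (h : Q →ₗ[R] LinearMap.range π),
      π ≠ 0 ∧ IsIdempotentElem π ∧ ∀ x : N', (h (f x) : N) = π x)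

/-- `N` belongs to `σ(M)`, i.e. `N` is subgenerated by `M`: it embeds into a factor module of a
direct sum of copies of `M`. -/
def IsSubgenerated (R : Type u) [Ring R] (M : Type v) [AddCommGroup M] [Module R M]
    (N : Type v) [AddCommGroup N] [Module R N] : Prop :=
  ∃ (Λ : Type v) (K : Submodule R (Λ →₀ M)) (j : N →ₗ[R] (Λ →₀ M) ⧸ K), Function.Injective j

/-- `P` is a projective object of `σ(M)`. (As `σ(M)` is closed under factor modules, its
epimorphisms are the surjective homomorphisms.) -/
def IsProjectiveInSigma (R : Type u) [Ring R] (M : Type v) [AddCommGroup M] [Module R M]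
    (P : Type v) [AddCommGroup P] [Module R P] : Prop :=
  IsSubgenerated R M P ∧
  ∀ (X Y : Type v) [AddCommGroup X] [Module R X] [AddCommGroup Y] [Module R Y],
    IsSubgenerated R M X → IsSubgenerated R M Y →
    ∀ (g : X →ₗ[R] Y) (f : P →ₗ[R] Y), Function.Surjective g → ∃ h : P →ₗ[R] X, g ∘ₗ h = f

/-- `N` is a `V`-module: every simple module is `N`-injective. -/
def IsVModule (R : Type u) [Ring R] (N : Type v) [AddCommGroup N] [Module R N] : Prop :=
  ∀ (S : Type v) [AddCommGroup S] [Module R S], IsSimpleModule R S → IsRelInjective R S N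

/-- `M` is an almost `V`-module: every simple module is almost `N`-injective for all `N ∈ σ(M)`. -/
def IsAlmostVModule (R : Type u) [Ring R] (M : Type v) [AddCommGroup M] [Module R M] : Prop :=
  ∀ (S : Type v) [AddCommGroup S] [Module R S], IsSimpleModule R S →
    ∀ (N : Type v) [AddCommGroup N] [Module R N], IsSubgenerated R M N →
      IsAlmostRelInjective R S N

/-- A local module: it has a largest proper submodule (in particular it is nonzero). -/
def IsLocalMod (R : Type u) [Ring R] (A : Type v) [AddCommGroup A] [Module R A] : Prop :=
  ∃ K : Submodule R A, K ≠ ⊤ ∧ ∀ L : Submodule R A, L ≠ ⊤ → L ≤ K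

/-- The Jacobson radical `J(A)` of a submodule `A` of `M`, regarded as a submodule of `M`. -/
def jacobsonOfSubmodule (R : Type u) [Ring R] (M : Type v) [AddCommGroup M] [Module R M]
    (A : Submodule R M) : Submodule R M :=
  (Module.jacobson R A).map A.subtype

/-!
All three conditions say that every nonsimple module of `σ(M)` with a monolith (a least nonzero
submodule) is projective in `σ(M)`. Such modules are the obstructions to extending homomorphisms
into simple modules: a homomorphism from a submodule of `N` onto a simple module, not extending to
`N`, yields by Zorn a factor module of `N` with a nonsimple monolith, and splitting off this factor
provides both the idempotent of an almost injectivity statement and the projective direct summand.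

When this projectivity holds, embed a nonsimple monolithic module `N` of `σ(M)` in an injective
module; the largest submodule of the latter in `σ(M)` is `M`-injective, and so is its direct summand
`E`, a monolithic factor module into which `N` embeds. Now `E` is not the sum of two proper
submodules, and its proper factor modules are `V`-modules, so that its monolith is its only maximal
submodule and its length is two; hence `N ≅ E`. A maximal independent family of such submodules of
`M` exhausts `J(M)`. Conversely, given the family of the third condition, a nonsimple monolithic `N`
embeds in a monolithic factor module `E` of a direct sum of copies of `M`; either some `A i` embeds
in `E`, which forces `N ≅ E ≅ A i`, or every map `M → E` kills `J(M)`, and `E` is a `V`-module,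
which is impossible.
-/

theorem injective_mapQ_map {R N N' : Type*} [Ring R] [AddCommGroup N] [Module R N]
    [AddCommGroup N'] [Module R N'] {j : N →ₗ[R] N'} (hj : Function.Injective j)
    (K : Submodule R N) : Function.Injective (K.mapQ (K.map j) j (K.le_comap_map j)) := by
  rw [← LinearMap.ker_eq_bot, Submodule.ker_mapQ, Submodule.comap_map_eq_of_injective hj,
    Submodule.mkQ_map_self]

theorem exists_comp_eq_of_ker_le {R A B C : Type*} [Ring R] [AddCommGroup A] [Module R A]
    [AddCommGroup B] [Module R B] [AddCommGroup C] [Module R C] {p : A →ₗ[R] B}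
    (hp : Function.Surjective p) {g : A →ₗ[R] C} (h : LinearMap.ker p ≤ LinearMap.ker g) :
    ∃ r : B →ₗ[R] C, r ∘ₗ p = g := by
  refine ⟨(LinearMap.ker p).liftQ g h ∘ₗ (p.quotKerEquivOfSurjective hp).symm.toLinearMap,
    LinearMap.ext fun x => ?_⟩
  have : (p.quotKerEquivOfSurjective hp).symm (p x) = (LinearMap.ker p).mkQ x := by
    rw [LinearEquiv.symm_apply_eq]; rfl
  simp [this]

theorem isCompl_range_ker_of_comp_eq_id {R N X : Type*} [Ring R] [AddCommGroup N] [Module R N]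
    [AddCommGroup X] [Module R X] {p : N →ₗ[R] X} {s : X →ₗ[R] N} (hps : p ∘ₗ s = LinearMap.id) :
    IsCompl (LinearMap.range s) (LinearMap.ker p) := by
  have hidem : IsIdempotentElem (s ∘ₗ p : Module.End R N) := by
    change s ∘ₗ (p ∘ₗ s) ∘ₗ p = s ∘ₗ p
    rw [hps, LinearMap.id_comp]
  have hcompl := LinearMap.IsIdempotentElem.isCompl hidem
  rwa [LinearMap.range_comp_of_range_eq_top _ (LinearMap.range_eq_top.2
      (LinearMap.surjective_of_comp_eq_id _ _ hps)), LinearMap.ker_comp_of_ker_eq_bot _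
      (LinearMap.ker_eq_bot.2 (LinearMap.injective_of_comp_eq_id _ _ hps))] at hcompl

section Subgenerated

variable {R : Type u} [Ring R] {M N N' : Type w} [AddCommGroup M] [Module R M]
  [AddCommGroup N] [Module R N] [AddCommGroup N'] [Module R N']

theorem IsSubgenerated.of_surjective_of_injective {Λ Q : Type w} [AddCommGroup Q] [Module R Q]
    (p : (Λ →₀ M) →ₗ[R] Q) (hp : Function.Surjective p) (j : N →ₗ[R] Q)
    (hj : Function.Injective j) : IsSubgenerated R M N :=
  ⟨Λ, LinearMap.ker p, (p.quotKerEquivOfSurjective hp).symm.toLinearMap ∘ₗ j,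
    (p.quotKerEquivOfSurjective hp).symm.injective.comp hj⟩

variable (R M) in
theorem IsSubgenerated.refl : IsSubgenerated R M M :=
  .of_surjective_of_injective (Finsupp.lapply PUnit.unit)
    (fun x => ⟨Finsupp.single PUnit.unit x, by simp⟩) LinearMap.id Function.injective_id

theorem IsSubgenerated.of_injective (hN : IsSubgenerated R M N) (i : N' →ₗ[R] N)
    (hi : Function.Injective i) : IsSubgenerated R M N' := by
  obtain ⟨Λ, K, j, hj⟩ := hN
  exact ⟨Λ, K, j ∘ₗ i, hj.comp hi⟩

theorem IsSubgenerated.of_surjective (hN : IsSubgenerated R M N) (p : N →ₗ[R] N')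
    (hp : Function.Surjective p) : IsSubgenerated R M N' := by
  obtain ⟨Λ, K, j, hj⟩ := hN
  exact .of_surjective_of_injective (((LinearMap.ker p).map j).mkQ ∘ₗ K.mkQ)
    ((Submodule.mkQ_surjective _).comp (Submodule.mkQ_surjective _))
    (Submodule.mapQ _ _ j (Submodule.le_comap_map j _) ∘ₗ
      (p.quotKerEquivOfSurjective hp).symm.toLinearMap)
    ((injective_mapQ_map hj _).comp (p.quotKerEquivOfSurjective hp).symm.injective)

theorem IsSubgenerated.range (hN : IsSubgenerated R M N) (f : N →ₗ[R] N') :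
    IsSubgenerated R M (LinearMap.range f) :=
  hN.of_surjective f.rangeRestrict f.surjective_rangeRestrict

theorem IsSubgenerated.dfinsupp {ι : Type w} {X : ι → Type w} [∀ i, AddCommGroup (X i)]
    [∀ i, Module R (X i)] (h : ∀ i, IsSubgenerated R M (X i)) :
    IsSubgenerated R M (Π₀ i, X i) := by
  classical
  choose Λ K j hj using h
  refine .of_surjective_of_injective (Λ := Σ i, Λ i) (Q := Π₀ i, (Λ i →₀ M) ⧸ K i)
    (DFinsupp.mapRange.linearMap (fun i => (K i).mkQ) ∘ₗ
      (sigmaFinsuppLequivDFinsupp R).toLinearMap) ?_ (DFinsupp.mapRange.linearMap j) ?_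
  · exact ((DFinsupp.mapRange_surjective _ fun _ => map_zero _).2
      fun _ => Submodule.mkQ_surjective _).comp (sigmaFinsuppLequivDFinsupp R).surjective
  · exact (DFinsupp.mapRange_injective _ fun _ => map_zero _).2 hj

theorem isSubgenerated_sSup {s : Set (Submodule R N)} (h : ∀ A ∈ s, IsSubgenerated R M A) :
    IsSubgenerated R M ↥(sSup s) := by
  classical
  rw [sSup_eq_iSup', Submodule.iSup_eq_range_dfinsupp_lsum]
  exact (IsSubgenerated.dfinsupp fun A : s => h A A.2).range _

theorem IsSubgenerated.prod (hN : IsSubgenerated R M N) (hN' : IsSubgenerated R M N') :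
    IsSubgenerated R M (N × N') := by
  have h : IsSubgenerated R M
      ↥(sSup {LinearMap.range (LinearMap.inl R N N'), LinearMap.range (LinearMap.inr R N N')}) :=
    isSubgenerated_sSup (by rintro _ (rfl | rfl); exacts [hN.range _, hN'.range _])
  rw [sSup_pair, LinearMap.sup_range_inl_inr] at h
  exact h.of_surjective Submodule.topEquiv.toLinearMap Submodule.topEquiv.surjective

end Subgenerated

section RelInjective

variable {R : Type u} [Ring R] {Q : Type v} [AddCommGroup Q] [Module R Q]
  {N N' : Type*} [AddCommGroup N] [Module R N] [AddCommGroup N'] [Module R N']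

theorem IsRelInjective.exists_comp_eq (h : IsRelInjective R Q N) {i : N' →ₗ[R] N}
    (hi : Function.Injective i) (f : N' →ₗ[R] Q) : ∃ g : N →ₗ[R] Q, g ∘ₗ i = f := by
  obtain ⟨g, hg⟩ := h (LinearMap.range i) (f ∘ₗ (LinearEquiv.ofInjective i hi).symm.toLinearMap)
  refine ⟨g, LinearMap.ext fun x => ?_⟩
  simpa using LinearMap.congr_fun hg (LinearEquiv.ofInjective i hi x)

theorem IsRelInjective.of_injective (h : IsRelInjective R Q N) {i : N' →ₗ[R] N}
    (hi : Function.Injective i) : IsRelInjective R Q N' := fun L f => by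
  obtain ⟨g, hg⟩ := h.exists_comp_eq (i := i ∘ₗ L.subtype) (hi.comp L.injective_subtype) f
  exact ⟨g ∘ₗ i, hg⟩

theorem IsRelInjective.of_surjective (h : IsRelInjective R Q N) {p : N →ₗ[R] N'}
    (hp : Function.Surjective p) : IsRelInjective R Q N' := fun L f => by
  obtain ⟨g, hg⟩ := h (L.comap p) (f ∘ₗ p.restrict fun _ hx => hx)
  have hgf (x : N) (hx : p x ∈ L) : g x = f ⟨p x, hx⟩ := LinearMap.congr_fun hg ⟨x, hx⟩
  have hker : LinearMap.ker p ≤ LinearMap.ker g := fun x (hx : p x = 0) => by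
    have hxL : p x ∈ L := hx ▸ L.zero_mem
    have h0 : (⟨p x, hxL⟩ : L) = 0 := Subtype.ext hx
    rw [LinearMap.mem_ker, hgf x hxL, h0, map_zero]
  obtain ⟨r, rfl⟩ := exists_comp_eq_of_ker_le hp hker
  refine ⟨r, LinearMap.ext fun ⟨y, hy⟩ => ?_⟩
  obtain ⟨x, rfl⟩ := hp y
  exact hgf x hy

theorem IsRelInjective.of_retraction {Q' : Type*} [AddCommGroup Q'] [Module R Q']
    (h : IsRelInjective R Q N) {s : Q' →ₗ[R] Q} {r : Q →ₗ[R] Q'} (hrs : r ∘ₗ s = LinearMap.id) :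
    IsRelInjective R Q' N := fun L f => by
  obtain ⟨g, hg⟩ := h L (s ∘ₗ f)
  exact ⟨r ∘ₗ g, by rw [LinearMap.comp_assoc, hg, ← LinearMap.comp_assoc, hrs, LinearMap.id_comp]⟩

theorem IsRelInjective.exists_linearPMap_ge {A : Submodule R N} (h : IsRelInjective R Q A)
    (g : N →ₗ.[R] Q) : ∃ g' : N →ₗ.[R] Q, g ≤ g' ∧ A ≤ g'.domain := by
  obtain ⟨k, hk⟩ := h (g.domain.comap A.subtype) (g.toFun ∘ₗ A.subtype.restrict fun _ hx => hx)
  have hagree : ∀ (x : g.domain) (y : (⟨A, k⟩ : N →ₗ.[R] Q).domain), (x : N) = y →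
      g x = (⟨A, k⟩ : N →ₗ.[R] Q) y := by
    rintro ⟨x, hx⟩ ⟨y, hy⟩ (rfl : x = y)
    exact (LinearMap.congr_fun hk ⟨⟨x, hy⟩, hx⟩).symm
  exact ⟨_, LinearPMap.left_le_sup _ _ hagree, (LinearPMap.right_le_sup _ _ hagree).1⟩

theorem IsRelInjective.of_iSup_range_eq_top {ι : Type*} {X : ι → Type*} [∀ i, AddCommGroup (X i)]
    [∀ i, Module R (X i)] (h : ∀ i, IsRelInjective R Q (X i)) {f : ∀ i, X i →ₗ[R] N}
    (hf : ⨆ i, LinearMap.range (f i) = ⊤) : IsRelInjective R Q N := fun L φ => by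
  obtain ⟨g, hφg, hg⟩ := zorn_le_nonempty_Ici₀ (⟨L, φ⟩ : N →ₗ.[R] Q)
    (fun c _ hc _ _ => ⟨LinearPMap.sSup c hc.directedOn,
      fun _ hz => LinearPMap.le_sSup hc.directedOn hz⟩) _ le_rfl
  have htop : g.domain = ⊤ := by
    rw [eq_top_iff, ← hf, iSup_le_iff]
    intro i
    obtain ⟨g', hgg', hi⟩ :=
      ((h i).of_surjective (f i).surjective_rangeRestrict).exists_linearPMap_ge g
    exact hi.trans (hg hgg').1
  exact ⟨g.toFun ∘ₗ LinearMap.codRestrict g.domain LinearMap.id fun _ => htop ▸ trivial,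
    LinearMap.ext fun x => (hφg.2 (y := ⟨x, hφg.1 x.2⟩) rfl).symm⟩

theorem IsRelInjective.of_isSubgenerated {M N : Type w} [AddCommGroup M] [Module R M]
    [AddCommGroup N] [Module R N] (h : IsRelInjective R Q M) (hN : IsSubgenerated R M N) :
    IsRelInjective R Q N := by
  obtain ⟨Λ, K, j, hj⟩ := hN
  have hsum : IsRelInjective R Q (Λ →₀ M) :=
    .of_iSup_range_eq_top (fun _ => h) Finsupp.iSup_lsingle_range
  exact (hsum.of_surjective K.mkQ_surjective).of_injective hj

end RelInjective

section RelProjective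

variable {R : Type u} [Ring R] {P : Type v} [AddCommGroup P] [Module R P]
  {N N' : Type*} [AddCommGroup N] [Module R N] [AddCommGroup N'] [Module R N']

theorem IsRelProjective.exists_comp_eq (h : IsRelProjective R P N) {Y : Type*} [AddCommGroup Y]
    [Module R Y] {g : N →ₗ[R] Y} {f : P →ₗ[R] Y}
    (hfg : LinearMap.range f ≤ LinearMap.range g) : ∃ k : P →ₗ[R] N, g ∘ₗ k = f := by
  obtain ⟨k, hk⟩ := h (LinearMap.ker g) (g.quotKerEquivRange.symm.toLinearMap ∘ₗ
    f.codRestrict (LinearMap.range g) fun x => hfg ⟨x, rfl⟩)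
  refine ⟨k, LinearMap.ext fun x => ?_⟩
  have := congrArg g.quotKerEquivRange (LinearMap.congr_fun hk x)
  simpa using congrArg Subtype.val this

theorem IsRelProjective.of_surjective (h : IsRelProjective R P N) {p : N →ₗ[R] N'}
    (hp : Function.Surjective p) : IsRelProjective R P N' := fun K f => by
  have hrange : LinearMap.range (K.mkQ ∘ₗ p) = ⊤ :=
    LinearMap.range_eq_top.2 (K.mkQ_surjective.comp hp)
  obtain ⟨k, hk⟩ := h.exists_comp_eq (g := K.mkQ ∘ₗ p) (f := f) (hrange ▸ le_top)
  exact ⟨p ∘ₗ k, hk⟩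

theorem IsRelProjective.of_injective (h : IsRelProjective R P N) {i : N' →ₗ[R] N}
    (hi : Function.Injective i) : IsRelProjective R P N' := fun K f => by
  set j := K.mapQ (K.map i) i (K.le_comap_map i)
  obtain ⟨k, hk⟩ := h (K.map i) (j ∘ₗ f)
  have hrange (x : P) : k x ∈ LinearMap.range i := by
    obtain ⟨y, hy⟩ := K.mkQ_surjective (f x)
    have hmk : (K.map i).mkQ (k x) = (K.map i).mkQ (i y) := by
      rw [← LinearMap.comp_apply, hk, LinearMap.comp_apply, ← hy]
      rfl
    have hsub : k x - i y ∈ LinearMap.range i :=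
      LinearMap.map_le_range ((Submodule.Quotient.eq _).1 hmk)
    simpa using add_mem hsub (LinearMap.mem_range_self i y)
  obtain ⟨l, hl⟩ : ∃ l : P →ₗ[R] N', i ∘ₗ l = k :=
    ⟨(LinearEquiv.ofInjective i hi).symm.toLinearMap ∘ₗ k.codRestrict _ hrange,
      LinearMap.ext fun x => congrArg Subtype.val
        ((LinearEquiv.ofInjective i hi).apply_symm_apply ⟨k x, hrange x⟩)⟩
  refine ⟨l, (LinearMap.cancel_left (injective_mapQ_map hi K)).1 ?_⟩
  rw [← LinearMap.comp_assoc, Submodule.mapQ_mkQ, LinearMap.comp_assoc, hl, hk]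

theorem exists_sum_comp_eq_of_isRelProjective {ι : Type*} {X : ι → Type*}
    [∀ i, AddCommGroup (X i)] [∀ i, Module R (X i)] {t : Finset ι}
    (h : ∀ i ∈ t, IsRelProjective R P (X i)) {Y : Type*} [AddCommGroup Y] [Module R Y]
    (g : ∀ i, X i →ₗ[R] Y) {f : P →ₗ[R] Y}
    (hf : LinearMap.range f ≤ ⨆ i ∈ t, LinearMap.range (g i)) :
    ∃ k : ∀ i, P →ₗ[R] X i, ∀ x, ∑ i ∈ t, g i (k i x) = f x := by
  classical
  induction t using Finset.induction_on generalizing Y with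
  | empty =>
    have hf0 : f = 0 := LinearMap.range_eq_bot.1 (le_bot_iff.1 (hf.trans (by simp)))
    exact ⟨0, fun x => by simp [hf0]⟩
  | insert i t hi ih =>
    set q := (LinearMap.range (g i)).mkQ
    obtain ⟨k, hk⟩ := ih (fun j hj => h j (Finset.mem_insert_of_mem hj)) (fun j => q ∘ₗ g j)
      (f := q ∘ₗ f) (by
        have hq : (LinearMap.range (g i)).map q = ⊥ := Submodule.mkQ_map_self _
        have := Submodule.map_mono (f := q) hf
        simpa only [Finset.iSup_insert, Submodule.map_sup, hq, bot_sup_eq, Submodule.map_iSup,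
          ← LinearMap.range_comp] using this)
    obtain ⟨l, hl⟩ := (h i (Finset.mem_insert_self i t)).exists_comp_eq (g := g i)
      (f := f - ∑ j ∈ t, g j ∘ₗ k j) (by
        rintro _ ⟨x, rfl⟩
        rw [← Submodule.Quotient.mk_eq_zero, ← Submodule.mkQ_apply]
        simpa [-Submodule.mkQ_apply, sub_eq_zero] using (hk x).symm)
    refine ⟨Function.update k i l, fun x => ?_⟩
    have hsum : ∑ j ∈ t, g j (Function.update k i l j x) = ∑ j ∈ t, g j (k j x) :=
      Finset.sum_congr rfl fun j hj => by rw [Function.update_of_ne (ne_of_mem_of_not_mem hj hi)]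
    have hl' : g i (l x) = f x - ∑ j ∈ t, g j (k j x) := by simpa using LinearMap.congr_fun hl x
    rw [Finset.sum_insert hi, hsum, Function.update_self, hl', sub_add_cancel]

theorem IsRelProjective.of_iSup_range_eq_top [Module.Finite R P] {ι : Type*} {X : ι → Type*}
    [∀ i, AddCommGroup (X i)] [∀ i, Module R (X i)] (h : ∀ i, IsRelProjective R P (X i))
    {g : ∀ i, X i →ₗ[R] N} (hg : ⨆ i, LinearMap.range (g i) = ⊤) : IsRelProjective R P N :=
  fun K f => by
  have hle : LinearMap.range f ≤ ⨆ i, LinearMap.range (K.mkQ ∘ₗ g i) := by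
    simp only [LinearMap.range_comp, ← Submodule.map_iSup, hg, Submodule.map_top,
      Submodule.range_mkQ, le_top]
  have hcompact := (Submodule.fg_iff_compact _).1 (Module.Finite.fg_top.map f)
  rw [Submodule.map_top] at hcompact
  obtain ⟨t, ht⟩ := CompleteLattice.IsCompactElement.exists_finset_of_le_iSup _ hcompact _ hle
  obtain ⟨k, hk⟩ := exists_sum_comp_eq_of_isRelProjective (fun i _ => h i) _ ht
  exact ⟨∑ i ∈ t, g i ∘ₗ k i, LinearMap.ext fun x => by simpa using hk x⟩

theorem IsRelProjective.of_isSubgenerated [Module.Finite R P] {M N : Type w}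
    [AddCommGroup M] [Module R M] [AddCommGroup N] [Module R N]
    (h : IsRelProjective R P M) (hN : IsSubgenerated R M N) :
    IsRelProjective R P N := by
  obtain ⟨Λ, K, j, hj⟩ := hN
  have hsum : IsRelProjective R P (Λ →₀ M) :=
    .of_iSup_range_eq_top (fun _ => h) Finsupp.iSup_lsingle_range
  exact (hsum.of_surjective K.mkQ_surjective).of_injective hj

end RelProjective

section ProjectiveInSigma

variable {R : Type u} [Ring R] {M P P' X : Type w} [AddCommGroup M] [Module R M]
  [AddCommGroup P] [Module R P] [AddCommGroup P'] [Module R P'] [AddCommGroup X] [Module R X]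

theorem IsProjectiveInSigma.of_isRelProjective [Module.Finite R P] (hP : IsSubgenerated R M P)
    (h : IsRelProjective R P M) : IsProjectiveInSigma R M P :=
  ⟨hP, fun _ _ _ _ _ _ hX _ _ _ hg => (h.of_isSubgenerated hX).exists_comp_eq
    (LinearMap.range_eq_top.2 hg ▸ le_top)⟩

theorem IsProjectiveInSigma.isRelProjective (h : IsProjectiveInSigma R M P) :
    IsRelProjective R P M := fun K f =>
  h.2 _ _ (.refl R M) ((IsSubgenerated.refl R M).of_surjective K.mkQ K.mkQ_surjective) K.mkQ f
    K.mkQ_surjective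

theorem IsProjectiveInSigma.of_equiv (h : IsProjectiveInSigma R M P) (e : P ≃ₗ[R] P') :
    IsProjectiveInSigma R M P' :=
  ⟨h.1.of_surjective e.toLinearMap e.surjective, fun X Y _ _ _ _ hX hY g f hg => by
    obtain ⟨k, hk⟩ := h.2 X Y hX hY g (f ∘ₗ e.toLinearMap) hg
    refine ⟨k ∘ₗ e.symm.toLinearMap, LinearMap.ext fun x => ?_⟩
    simpa using LinearMap.congr_fun hk (e.symm x)⟩

theorem IsProjectiveInSigma.exists_section (h : IsProjectiveInSigma R M P)
    (hX : IsSubgenerated R M X) {p : X →ₗ[R] P} (hp : Function.Surjective p) :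
    ∃ s : P →ₗ[R] X, p ∘ₗ s = LinearMap.id :=
  h.2 X P hX h.1 p LinearMap.id hp

theorem isProjectiveInSigma_of_forall_exists_section (hP : IsSubgenerated R M P)
    (h : ∀ (X : Type w) [AddCommGroup X] [Module R X], IsSubgenerated R M X →
      ∀ p : X →ₗ[R] P, Function.Surjective p → ∃ s : P →ₗ[R] X, p ∘ₗ s = LinearMap.id) :
    IsProjectiveInSigma R M P := by
  refine ⟨hP, fun X Y _ _ _ _ hX _ g f hg => ?_⟩
  let pullback : Submodule R (X × P) :=
    LinearMap.eqLocus (g ∘ₗ LinearMap.fst R X P) (f ∘ₗ LinearMap.snd R X P)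
  obtain ⟨s, hs⟩ := h pullback ((hX.prod hP).of_injective _ pullback.injective_subtype)
    (LinearMap.snd R X P ∘ₗ pullback.subtype) fun y => by
      obtain ⟨x, hx⟩ := hg (f y)
      exact ⟨⟨(x, y), hx⟩, rfl⟩
  refine ⟨LinearMap.fst R X P ∘ₗ pullback.subtype ∘ₗ s, LinearMap.ext fun y => ?_⟩
  have hsnd : (s y : X × P).2 = y := LinearMap.congr_fun hs y
  exact (s y).2.trans (congrArg f hsnd)

end ProjectiveInSigma

section Monolith

variable {R : Type u} [Ring R] {N : Type w} [AddCommGroup N] [Module R N] {S : Submodule R N}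
  {X : Type*} [AddCommGroup X] [Module R X]

/-- The monolith of a module is its least nonzero submodule; a module has one exactly when it is
subdirectly irreducible (cocyclic). -/
def IsMonolith (S : Submodule R N) : Prop :=
  IsLeast {L : Submodule R N | L ≠ ⊥} S

theorem IsMonolith.isAtom (h : IsMonolith S) : IsAtom S :=
  ⟨h.1, fun _ hL => by_contra fun hL' => hL.not_ge (h.2 hL')⟩

theorem IsMonolith.isSimpleModule (h : IsMonolith S) : IsSimpleModule R S :=
  isSimpleModule_iff_isAtom.2 h.isAtom

theorem IsMonolith.nontrivial (h : IsMonolith S) : Nontrivial N :=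
  let ⟨x, _, hx⟩ := Submodule.exists_mem_ne_zero_of_ne_bot h.1
  nontrivial_of_ne x 0 hx

theorem IsMonolith.range_ne_bot_of_injective (h : IsMonolith S) {f : N →ₗ[R] X}
    (hf : Function.Injective f) : LinearMap.range f ≠ ⊥ := fun h0 => by
  obtain ⟨x, -, hx⟩ := Submodule.exists_mem_ne_zero_of_ne_bot h.1
  exact hx (hf (by rw [LinearMap.range_eq_bot.1 h0, LinearMap.zero_apply, LinearMap.zero_apply]))

theorem IsMonolith.eq_bot_or_eq_bot (h : IsMonolith S) {A B : Submodule R N}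
    (hAB : Disjoint A B) : A = ⊥ ∨ B = ⊥ := by
  by_contra! hne
  exact h.1 (le_bot_iff.1 (hAB (h.2 hne.1) (h.2 hne.2)))

theorem IsMonolith.le_ker_of_not_injective (h : IsMonolith S) {f : N →ₗ[R] X}
    (hf : ¬ Function.Injective f) : S ≤ LinearMap.ker f :=
  h.2 fun hker => hf (LinearMap.ker_eq_bot.1 hker)

theorem IsMonolith.map_le_of_not_disjoint (h : IsMonolith S) {f : N →ₗ[R] X}
    {B : Submodule R X} (hB : ¬ Disjoint (LinearMap.range f) B) : S.map f ≤ B := by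
  refine Submodule.map_le_iff_le_comap.2 (h.2 fun h0 => hB (Submodule.disjoint_def.2 ?_))
  rintro _ ⟨x, rfl⟩ hx
  have hx0 : x ∈ B.comap f := hx
  rw [h0, Submodule.mem_bot] at hx0
  rw [hx0, map_zero]

theorem IsMonolith.range_le_of_isSimpleModule (h : IsMonolith S) [IsSimpleModule R X]
    (f : X →ₗ[R] N) : LinearMap.range f ≤ S := by
  obtain hf | rfl := f.injective_or_eq_zero
  · have hatom : IsAtom (LinearMap.range f) := isSimpleModule_iff_isAtom.1
      (IsSimpleModule.congr (LinearEquiv.ofInjective f hf).symm)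
    exact ((hatom.le_iff.1 (h.2 hatom.1)).resolve_left h.1).ge
  · simp

theorem IsMonolith.map_equiv (h : IsMonolith S) (e : N ≃ₗ[R] X) :
    IsMonolith (S.map e.toLinearMap) := by
  refine ⟨fun h0 => h.1 (Submodule.map_eq_bot_iff.1 h0), fun L hL => ?_⟩
  refine Submodule.map_le_iff_le_comap.2 (h.2 fun h0 => hL ?_)
  rw [← Submodule.map_comap_eq_of_surjective e.surjective L, h0, Submodule.map_bot]

theorem IsMonolith.not_range_le_of_isAtom (h : IsMonolith S) (hS : S ≠ ⊤) {f : N →ₗ[R] X}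
    (hf : Function.Injective f) {T : Submodule R X} (hT : IsAtom T) :
    ¬ LinearMap.range f ≤ T := fun hle => by
  have hlt : S.map f < LinearMap.range f :=
    LinearMap.range_eq_map f ▸ Submodule.map_strictMono_of_injective hf hS.lt_top
  have hbot : S.map f = ⊥ := hT.2 _ (hlt.trans_le hle)
  exact h.1 (Submodule.map_injective_of_injective hf (hbot.trans (Submodule.map_bot f).symm))

theorem IsMonolith.ne_top_of_injective (h : IsMonolith S) (hS : S ≠ ⊤) {f : N →ₗ[R] X}
    (hf : Function.Injective f) {T : Submodule R X} (hT : IsMonolith T) : T ≠ ⊤ := fun h0 =>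
  h.not_range_le_of_isAtom hS hf hT.isAtom (h0 ▸ le_top)

theorem IsMonolith.surjective_of_injective (h : IsMonolith S) (hS : S ≠ ⊤) {f : N →ₗ[R] X}
    (hf : Function.Injective f) {T : Submodule R X} (hT : IsMonolith T) (hT' : IsCoatom T) :
    Function.Surjective f := by
  have hnle := h.not_range_le_of_isAtom hS hf hT.isAtom
  have hle : T ≤ LinearMap.range f := hT.2 fun h0 => hnle (h0 ▸ bot_le)
  exact LinearMap.range_eq_top.1 ((hT'.le_iff.1 hle).resolve_right fun h0 => hnle h0.le)

theorem IsMonolith.eq_zero_or_eq_one (h : IsMonolith S) {e : Module.End R N}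
    (he : IsIdempotentElem e) : e = 0 ∨ e = 1 := by
  have hee (x : N) : e (e x) = e x := LinearMap.congr_fun he x
  refine (h.eq_bot_or_eq_bot (LinearMap.IsIdempotentElem.isCompl he).disjoint).imp
    LinearMap.range_eq_bot.1 fun hker => LinearMap.ext fun x => ?_
  exact LinearMap.ker_eq_bot.1 hker (hee x)

theorem IsMonolith.comp_eq_id [Nontrivial X] (h : IsMonolith S) {p : N →ₗ[R] X} {s : X →ₗ[R] N}
    (hps : p ∘ₗ s = LinearMap.id) : s ∘ₗ p = LinearMap.id := by
  have hps' (x : X) : p (s x) = x := LinearMap.congr_fun hps x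
  have hidem : IsIdempotentElem (s ∘ₗ p : Module.End R N) :=
    LinearMap.ext fun x => congrArg s (hps' (p x))
  refine (h.eq_zero_or_eq_one hidem).resolve_left fun h0 => ?_
  obtain ⟨x, hx⟩ := exists_ne (0 : X)
  have hsx : s x = 0 := by rw [← hps' x]; exact LinearMap.congr_fun h0 (s x)
  rw [← hps' x, hsx, map_zero] at hx
  exact hx rfl

theorem IsMonolith.eq_top_of_retraction (h : IsMonolith S) {r : N →ₗ[R] S}
    (hr : r ∘ₗ S.subtype = LinearMap.id) : S = ⊤ := by
  have := Submodule.nontrivial_iff_ne_bot.2 h.1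
  rw [← S.range_subtype, LinearMap.range_eq_top]
  exact LinearMap.surjective_of_comp_eq_id _ _ (h.comp_eq_id hr)

theorem IsMonolith.eq_top_of_isVModule (h : IsMonolith S) (hN : IsVModule R N) : S = ⊤ := by
  obtain ⟨r, hr⟩ := hN S h.isSimpleModule S LinearMap.id
  exact h.eq_top_of_retraction hr

theorem IsMonolith.isCoatom_of_eq_top {C : Submodule R N} {T : Submodule R (N ⧸ C)}
    (hT : IsMonolith T) (hT' : T = ⊤) : IsCoatom C := by
  subst hT'
  have := hT.isSimpleModule
  exact isSimpleModule_iff_isCoatom.1 (IsSimpleModule.congr Submodule.topEquiv.symm)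

theorem IsMonolith.jacobson_eq (h : IsMonolith S) (hS : IsCoatom S) :
    Module.jacobson R N = S := by
  refine le_antisymm (sInf_le hS) (le_sInf fun L (hL : IsCoatom L) => h.2 ?_)
  rintro rfl
  exact hS.1 (hL.2 S (bot_lt_iff_ne_bot.2 h.1))

theorem IsMonolith.isLocalMod (h : IsMonolith S) (hS : IsCoatom S) : IsLocalMod R N := by
  refine ⟨S, hS.1, fun L hL => ?_⟩
  rcases eq_or_ne L ⊥ with rfl | hL0
  · exact bot_le
  · exact ((hS.le_iff.1 (h.2 hL0)).resolve_left hL).le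

theorem IsMonolith.length_eq_two (h : IsMonolith S) (hS : IsCoatom S) :
    Module.length R N = 2 := by
  have := h.isSimpleModule
  have := isSimpleModule_iff_isCoatom.2 hS
  rw [Module.length_eq_add_of_exact S.subtype S.mkQ S.injective_subtype S.mkQ_surjective
    (LinearMap.exact_subtype_mkQ S), Module.length_eq_one, Module.length_eq_one,
    one_add_one_eq_two]

theorem IsLocalMod.exists_isMonolith_isCoatom (h : IsLocalMod R N) (hN : Module.length R N = 2) :
    ∃ K : Submodule R N, IsMonolith K ∧ IsCoatom K := by
  obtain ⟨K, hK, hmax⟩ := h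
  have hco : IsCoatom K := ⟨hK, fun L hL => by_contra fun hL' => hL.not_ge (hmax L hL')⟩
  have := isSimpleModule_iff_isCoatom.2 hco
  rw [Module.length_eq_add_of_exact K.subtype K.mkQ K.injective_subtype K.mkQ_surjective
    (LinearMap.exact_subtype_mkQ K), Module.length_eq_one R (N ⧸ K)] at hN
  have hlen : Module.length R K = 1 :=
    WithTop.add_right_cancel WithTop.one_ne_top (hN.trans one_add_one_eq_two.symm)
  have hatom : IsAtom K := isSimpleModule_iff_isAtom.1 (Module.length_eq_one_iff.1 hlen)
  refine ⟨K, ⟨hatom.1, fun L hL => ?_⟩, hco⟩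
  rcases eq_or_ne L ⊤ with rfl | hL'
  · exact le_top
  · exact ((hatom.le_iff.1 (hmax L hL')).resolve_left hL).ge

theorem exists_quotient_isMonolith (K : Submodule R N) {x : N} (hx : x ∉ K) :
    ∃ C : Submodule R N, K ≤ C ∧ x ∉ C ∧ IsMonolith (Submodule.span R {C.mkQ x}) := by
  obtain ⟨C, hKC, hC⟩ := zorn_le_nonempty₀ {C : Submodule R N | x ∉ C}
    (fun c hc hchain D hD => ⟨sSup c, by
      rw [Set.mem_ofPred_eq, Submodule.mem_sSup_of_directed ⟨D, hD⟩ hchain.directedOn]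
      rintro ⟨E, hE, hxE⟩
      exact hc hE hxE, fun z hz => le_sSup hz⟩) K hx
  refine ⟨C, hKC, hC.1, by simpa using hC.1, fun L hL => ?_⟩
  by_contra hxL
  have hcomap : L.comap C.mkQ ≤ C :=
    hC.2 (fun h => hxL ((Submodule.span_singleton_le_iff_mem _ _).2 h)) (C.le_comap_mkQ L)
  refine hL (le_bot_iff.1 ?_)
  rw [← Submodule.map_comap_eq_of_surjective C.mkQ_surjective L]
  exact (Submodule.map_mono hcomap).trans C.mkQ_map_self.le

theorem IsMonolith.exists_quotient_injective (h : IsMonolith S) {f : N →ₗ[R] X}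
    (hf : Function.Injective f) : ∃ (C : Submodule R X) (T : Submodule R (X ⧸ C)),
      IsMonolith T ∧ Function.Injective (C.mkQ ∘ₗ f) := by
  obtain ⟨x, hx, hx0⟩ := Submodule.exists_mem_ne_zero_of_ne_bot h.1
  obtain ⟨C, -, hxC, hT⟩ := exists_quotient_isMonolith (⊥ : Submodule R X) (x := f x)
    (by simpa using (map_ne_zero_iff f hf).2 hx0)
  refine ⟨C, _, hT, by_contra fun hninj => hxC ?_⟩
  simpa using h.le_ker_of_not_injective hninj hx

theorem exists_quotient_isMonolith_ne_top {K : Submodule R N} {x : N} (hx : x ∉ K)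
    (hxJ : x ∈ Module.jacobson R N) : ∃ (C : Submodule R N) (T : Submodule R (N ⧸ C)),
      K ≤ C ∧ IsMonolith T ∧ T ≠ ⊤ := by
  obtain ⟨C, hKC, hxC, hT⟩ := exists_quotient_isMonolith K hx
  exact ⟨C, _, hKC, hT, fun h0 => hxC ((sInf_le (hT.isCoatom_of_eq_top h0) : _ ≤ C) hxJ)⟩

theorem exists_quotient_of_not_extends [IsSimpleModule R X] {L : Submodule R N} {f : L →ₗ[R] X}
    (hf : ¬ ∃ g : N →ₗ[R] X, g ∘ₗ L.subtype = f) :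
    ∃ (C : Submodule R N) (T : Submodule R (N ⧸ C)) (k : X →ₗ[R] N ⧸ C),
      IsMonolith T ∧ T ≠ ⊤ ∧ k ∘ₗ f = C.mkQ ∘ₗ L.subtype := by
  obtain ⟨x, hx⟩ : ∃ x, f x ≠ 0 := by
    by_contra! hall
    exact hf ⟨0, LinearMap.ext fun x => (hall x).symm⟩
  have hsurj : Function.Surjective f :=
    LinearMap.surjective_of_ne_zero fun h0 => hx (LinearMap.congr_fun h0 x)
  obtain ⟨C, hKC, hxC, hT⟩ := exists_quotient_isMonolith
    ((LinearMap.ker f).map L.subtype) (x := (x : N)) (by simpa using hx)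
  have hker : LinearMap.ker f ≤ LinearMap.ker (C.mkQ ∘ₗ L.subtype) := by
    rwa [LinearMap.ker_comp, Submodule.ker_mkQ, ← Submodule.map_le_iff_le_comap]
  obtain ⟨k, hk⟩ := exists_comp_eq_of_ker_le hsurj hker
  have hkx : k (f x) = C.mkQ x := LinearMap.congr_fun hk x
  refine ⟨C, _, k, hT, fun htop => hf ?_, hk⟩
  have hkinj : Function.Injective k :=
    LinearMap.injective_of_ne_zero fun h0 => hxC (by simpa [h0] using hkx.symm)
  have hksurj : Function.Surjective k := by
    rw [← LinearMap.range_eq_top, eq_top_iff, ← htop, Submodule.span_singleton_le_iff_mem]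
    exact ⟨f x, hkx⟩
  let e := LinearEquiv.ofBijective k ⟨hkinj, hksurj⟩
  refine ⟨e.symm.toLinearMap ∘ₗ C.mkQ, ?_⟩
  rw [LinearMap.comp_assoc, ← hk]
  exact LinearMap.ext fun y => e.symm_apply_apply (f y)

theorem IsMonolith.eq_top_of_comp_subtype_eq_restrict (h : IsMonolith S)
    {p : X →ₗ[R] N} (hp : Function.Surjective p) {g : X →ₗ[R] S}
    (hg : g ∘ₗ (S.comap p).subtype = p.restrict fun _ hx => hx) : S = ⊤ := by
  have hg' (x : X) (hx : p x ∈ S) : g x = ⟨p x, hx⟩ := LinearMap.congr_fun hg ⟨x, hx⟩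
  have hker : LinearMap.ker p ≤ LinearMap.ker g := fun x (hx : p x = 0) => by
    rw [LinearMap.mem_ker, hg' x (hx ▸ S.zero_mem)]
    exact Subtype.ext hx
  obtain ⟨r, rfl⟩ := exists_comp_eq_of_ker_le hp hker
  refine h.eq_top_of_retraction (r := r) (LinearMap.ext fun ⟨y, hy⟩ => ?_)
  obtain ⟨x, rfl⟩ := hp y
  exact hg' x hy

theorem IsMonolith.exists_section_of_isIdempotentElem (h : IsMonolith S)
    {p : X →ₗ[R] N} (hp : Function.Surjective p) {π : Module.End R X}
    (hπ : IsIdempotentElem π) (hπ0 : π ≠ 0)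
    (hker : LinearMap.ker p ≤ LinearMap.ker π) : ∃ s : N →ₗ[R] X, p ∘ₗ s = LinearMap.id := by
  obtain ⟨q, rfl⟩ := exists_comp_eq_of_ker_le hp hker
  have hqpq : q ∘ₗ p ∘ₗ q = q := (LinearMap.cancel_right hp).1 hπ
  have hidem : IsIdempotentElem (p ∘ₗ q : Module.End R N) := congrArg (p ∘ₗ ·) hqpq
  refine (h.eq_zero_or_eq_one hidem).elim (fun h0 => absurd ?_ hπ0) fun h1 => ⟨q, h1⟩
  rw [← hqpq, h0, LinearMap.comp_zero, LinearMap.zero_comp]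

end Monolith

section VModule

variable {R : Type u} [Ring R] {N N' : Type w} [AddCommGroup N] [Module R N] [AddCommGroup N']
  [Module R N']

theorem IsVModule.of_surjective (h : IsVModule R N) {p : N →ₗ[R] N'}
    (hp : Function.Surjective p) : IsVModule R N' :=
  fun T _ _ hT => (h T hT).of_surjective hp

theorem IsVModule.of_iSup_range_eq_top {ι : Type*} {X : ι → Type w} [∀ i, AddCommGroup (X i)]
    [∀ i, Module R (X i)] (h : ∀ i, IsVModule R (X i)) {f : ∀ i, X i →ₗ[R] N}
    (hf : ⨆ i, LinearMap.range (f i) = ⊤) : IsVModule R N :=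
  fun T _ _ hT => .of_iSup_range_eq_top (fun i => h i T hT) hf

theorem IsVModule.jacobson_eq_bot (h : IsVModule R N) : Module.jacobson R N = ⊥ := by
  refine (Submodule.eq_bot_iff _).2 fun x hx => by_contra fun hx0 => ?_
  obtain ⟨C, T, -, hT, hT'⟩ :=
    exists_quotient_isMonolith_ne_top (K := ⊥) (by simpa using hx0) hx
  exact hT' (hT.eq_top_of_isVModule (h.of_surjective C.mkQ_surjective))

theorem exists_quotient_of_not_isVModule (h : ¬ IsVModule R N) :
    ∃ (C : Submodule R N) (T : Submodule R (N ⧸ C)), IsMonolith T ∧ T ≠ ⊤ := by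
  unfold IsVModule IsRelInjective at h
  push Not at h
  obtain ⟨X, _, _, hX, L, f, hf⟩ := h
  obtain ⟨C, T, -, hT, hT', -⟩ := exists_quotient_of_not_extends (by simpa using hf)
  exact ⟨C, T, hT, hT'⟩

end VModule

section MonolithicProjective

variable {R : Type u} [Ring R] {M : Type w} [AddCommGroup M] [Module R M]

variable (R M) in
/-- Every nonsimple module of `σ(M)` with a monolith is projective in `σ(M)`: the condition through
which the three conditions of the theorem are compared. -/
def MonolithicProjective : Prop :=
  ∀ (N : Type w) [AddCommGroup N] [Module R N], IsSubgenerated R M N →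
    ∀ S : Submodule R N, IsMonolith S → S ≠ ⊤ → IsProjectiveInSigma R M N

variable {N X : Type w} [AddCommGroup N] [Module R N] [AddCommGroup X] [Module R X]
  {S : Submodule R N} {p : X →ₗ[R] N}

theorem IsAlmostVModule.monolithicProjective (h : IsAlmostVModule R M) :
    MonolithicProjective R M := by
  intro N _ _ hN S hS hS'
  refine isProjectiveInSigma_of_forall_exists_section hN fun X _ _ hX p hp => ?_
  rcases h S hS.isSimpleModule X hX (S.comap p) (p.restrict fun _ hx => hx) with
    ⟨g, hg⟩ | ⟨π, k, hπ0, hπ, hk⟩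
  · exact absurd (hS.eq_top_of_comp_subtype_eq_restrict hp hg) hS'
  · refine hS.exists_section_of_isIdempotentElem hp hπ hπ0 fun x (hx : p x = 0) => ?_
    have hpx : (p.restrict fun _ hx => hx : S.comap p →ₗ[R] S) ⟨x, by simp [hx]⟩ = 0 :=
      Subtype.ext hx
    rw [LinearMap.mem_ker, ← hk ⟨x, by simp [hx]⟩, hpx, map_zero, Submodule.coe_zero]

theorem MonolithicProjective.exists_section (h : MonolithicProjective R M)
    (hX : IsSubgenerated R M X) (hp : Function.Surjective p) (hS : IsMonolith S) (hS' : S ≠ ⊤) :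
    ∃ s : N →ₗ[R] X, p ∘ₗ s = LinearMap.id :=
  (h N (hX.of_surjective p hp) S hS hS').exists_section hX hp

theorem MonolithicProjective.isAlmostVModule (h : MonolithicProjective R M) :
    IsAlmostVModule R M := by
  intro T _ _ _ N _ _ hN L f
  refine or_iff_not_imp_left.2 fun hf => ?_
  obtain ⟨C, S, k, hS, hS', hk⟩ := exists_quotient_of_not_extends hf
  obtain ⟨s, hs⟩ := h.exists_section hN C.mkQ_surjective hS hS'
  have hs' (y : N ⧸ C) : C.mkQ (s y) = y := LinearMap.congr_fun hs y
  refine ⟨s ∘ₗ C.mkQ, (s ∘ₗ k).codRestrict _ fun t => ⟨s (k t), congrArg s (hs' (k t))⟩,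
    fun h0 => hS.1 ?_, LinearMap.ext fun x => congrArg s (hs' (C.mkQ x)),
    fun x => congrArg s (LinearMap.congr_fun hk x)⟩
  refine (Submodule.eq_bot_iff S).2 fun y _ => ?_
  have hsy : s (C.mkQ (s y)) = 0 := LinearMap.congr_fun h0 (s y)
  rw [hs'] at hsy
  rw [← hs' y, hsy, map_zero]

theorem MonolithicProjective.exists_projective_summand (h : MonolithicProjective R M)
    (hN : IsSubgenerated R M N) (hV : ¬ IsVModule R N) :
    ∃ D C : Submodule R N, IsCompl D C ∧ D ≠ ⊥ ∧ IsProjectiveInSigma R M D := by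
  obtain ⟨C, S, hS, hS'⟩ := exists_quotient_of_not_isVModule hV
  obtain ⟨s, hs⟩ := h.exists_section hN C.mkQ_surjective hS hS'
  have hinj : Function.Injective s := LinearMap.injective_of_comp_eq_id _ _ hs
  refine ⟨LinearMap.range s, C, ?_, hS.range_ne_bot_of_injective hinj, ?_⟩
  · simpa only [Submodule.ker_mkQ] using isCompl_range_ker_of_comp_eq_id hs
  · exact (h _ (hN.of_surjective C.mkQ C.mkQ_surjective) S hS hS').of_equiv
      (LinearEquiv.ofInjective s hinj)

theorem monolithicProjective_of_exists_projective_summand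
    (h : ∀ (N : Type w) [AddCommGroup N] [Module R N], IsSubgenerated R M N →
      IsVModule R N ∨ ∃ D C : Submodule R N, IsCompl D C ∧ D ≠ ⊥ ∧ IsProjectiveInSigma R M D) :
    MonolithicProjective R M := by
  intro N _ _ hN S hS hS'
  obtain hV | ⟨D, C, hDC, hD, hP⟩ := h N hN
  · exact absurd (hS.eq_top_of_isVModule hV) hS'
  · obtain rfl : C = ⊥ := (hS.eq_bot_or_eq_bot hDC.disjoint).resolve_left hD
    obtain rfl : D = ⊤ := by simpa using hDC.sup_eq_top
    exact hP.of_equiv Submodule.topEquiv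

end MonolithicProjective

section Structure

variable {R : Type u} [Ring R] {M N X : Type w} [AddCommGroup M] [Module R M]
  [AddCommGroup N] [Module R N] [AddCommGroup X] [Module R X] {S : Submodule R N}

theorem MonolithicProjective.isVModule_of_not_injective (h : MonolithicProjective R M)
    (hN : IsSubgenerated R M N) (hS : IsMonolith S) {p : N →ₗ[R] X} (hp : Function.Surjective p)
    (hp' : ¬ Function.Injective p) : IsVModule R X := by
  by_contra hV
  obtain ⟨C, T, hT, hT'⟩ := exists_quotient_of_not_isVModule hV
  obtain ⟨s, hs⟩ := h.exists_section (p := C.mkQ ∘ₗ p) hN (C.mkQ_surjective.comp hp) hT hT'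
  have := hT.nontrivial
  have hsp := hS.comp_eq_id hs
  exact hp' (LinearMap.injective_of_comp_eq_id p (s ∘ₗ C.mkQ) hsp)

theorem IsMonolith.surjective_of_isRelInjective (hS : IsMonolith S) (hN : IsRelInjective R N N)
    {e : Module.End R N} (he : Function.Injective e) : Function.Surjective e := by
  obtain ⟨g, hg⟩ := hN.exists_comp_eq he LinearMap.id
  have := hS.nontrivial
  exact LinearMap.surjective_of_comp_eq_id _ _ (hS.comp_eq_id hg)

theorem IsMonolith.eq_top_or_eq_top (hS : IsMonolith S) (hN : IsRelInjective R N N)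
    (hP : IsProjectiveInSigma R M N) {A B : Submodule R N} (hAB : A ⊔ B = ⊤) :
    A = ⊤ ∨ B = ⊤ := by
  have hsurj : Function.Surjective (A.subtype.coprod B.subtype) := by
    rw [← LinearMap.range_eq_top, LinearMap.range_coprod, A.range_subtype, B.range_subtype, hAB]
  obtain ⟨s, hs⟩ := hP.exists_section ((hP.1.of_injective A.subtype A.injective_subtype).prod
    (hP.1.of_injective B.subtype B.injective_subtype)) hsurj
  let a : Module.End R N := A.subtype ∘ₗ LinearMap.fst R A B ∘ₗ s
  let b : Module.End R N := B.subtype ∘ₗ LinearMap.snd R A B ∘ₗ s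
  have hab (x : N) : a x + b x = x := LinearMap.congr_fun hs x
  have hdisj : Disjoint (LinearMap.ker a) (LinearMap.ker b) :=
    Submodule.disjoint_def.2 fun x (ha : a x = 0) (hb : b x = 0) => by
      rw [← hab x, ha, hb, add_zero]
  refine (hS.eq_bot_or_eq_bot hdisj).imp (fun h0 => ?_) fun h0 => ?_
  · refine eq_top_iff.2 fun x _ => ?_
    obtain ⟨y, rfl⟩ := hS.surjective_of_isRelInjective hN (LinearMap.ker_eq_bot.1 h0) x
    exact (s y).1.2
  · refine eq_top_iff.2 fun x _ => ?_
    obtain ⟨y, rfl⟩ := hS.surjective_of_isRelInjective hN (LinearMap.ker_eq_bot.1 h0) x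
    exact (s y).2.2

theorem MonolithicProjective.isCoatom_of_isRelInjective (h : MonolithicProjective R M)
    (hN : IsSubgenerated R M N) (hS : IsMonolith S) (hS' : S ≠ ⊤) (hinj : IsRelInjective R N M) :
    IsCoatom S := by
  have hV : IsVModule R (N ⧸ S) := h.isVModule_of_not_injective hN hS S.mkQ_surjective
    fun hmk => hS.1 (by rw [← S.ker_mkQ, LinearMap.ker_eq_bot.2 hmk])
  have hJ : Module.jacobson R N ≤ S := Module.jacobson_le_of_eq_bot hV.jacobson_eq_bot
  obtain ⟨C, hC⟩ : ∃ C : Submodule R N, IsCoatom C := by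
    by_contra! hnone
    refine hS' (top_le_iff.1 (hJ.trans' (le_sInf fun C hC => absurd hC (hnone C))))
  have huniq (D : Submodule R N) (hD : IsCoatom D) : C = D := by
    by_contra hne
    exact (hS.eq_top_or_eq_top (hinj.of_isSubgenerated hN) (h N hN S hS hS')
      (hC.sup_eq_top_of_ne hD hne)).elim hC.1 hD.1
  have hCJ : C ≤ Module.jacobson R N := le_sInf fun D hD => (huniq D hD).le
  rwa [(hC.le_iff.1 (hCJ.trans hJ)).resolve_left hS']

end Structure

section Injective

variable {R : Type u} [Ring R] {M N : Type w} [AddCommGroup M] [Module R M]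
  [AddCommGroup N] [Module R N] {S : Submodule R N}

theorem isRelInjective_sSup_isSubgenerated {Q : Type w} [AddCommGroup Q] [Module R Q]
    (hQ : Module.Injective R Q) :
    IsRelInjective R ↥(sSup {P : Submodule R Q | IsSubgenerated R M P}) M := fun L f => by
  let E : Submodule R Q := sSup {P : Submodule R Q | IsSubgenerated R M P}
  obtain ⟨g, hg⟩ := hQ.out L.subtype L.injective_subtype (E.subtype ∘ₗ f)
  have hgE : LinearMap.range g ≤ E := le_sSup ((IsSubgenerated.refl R M).range g)
  exact ⟨g.codRestrict E fun m => hgE ⟨m, rfl⟩, LinearMap.ext fun y => Subtype.ext (hg y)⟩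

variable [Small.{w} R]

variable (R N) in
theorem exists_injective_linearMap_to_injective :
    ∃ (Q : Type w) (_ : AddCommGroup Q) (_ : Module R Q) (i : N →ₗ[R] Q),
      Function.Injective i ∧ Module.Injective R Q := by
  obtain ⟨⟨J, hJ, f, hf⟩⟩ :=
    CategoryTheory.EnoughInjectives.presentation (ModuleCat.of R N)
  exact ⟨J, inferInstance, inferInstance, f.hom, (ModuleCat.mono_iff_injective f).1 hf,
    Module.injective_module_of_injective_object (inj := hJ) R J⟩

theorem IsSubgenerated.exists_injective_isRelInjective (hN : IsSubgenerated R M N) :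
    ∃ (E : Type w) (_ : AddCommGroup E) (_ : Module R E) (j : N →ₗ[R] E),
      Function.Injective j ∧ IsSubgenerated R M E ∧ IsRelInjective R E M := by
  obtain ⟨Q, _, _, i, hi, hQ⟩ := exists_injective_linearMap_to_injective R N
  have hiE : LinearMap.range i ≤ sSup {P : Submodule R Q | IsSubgenerated R M P} :=
    le_sSup (hN.range i)
  exact ⟨_, _, _, i.codRestrict _ fun x => hiE ⟨x, rfl⟩,
    fun x y hxy => hi (congrArg Subtype.val hxy), isSubgenerated_sSup fun _ hP => hP,
    isRelInjective_sSup_isSubgenerated hQ⟩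

theorem MonolithicProjective.isRelInjective (h : MonolithicProjective R M)
    (hN : IsSubgenerated R M N) (hS : IsMonolith S) (hS' : S ≠ ⊤) : IsRelInjective R N M := by
  obtain ⟨E, _, _, j, hj, hE, hEinj⟩ := hN.exists_injective_isRelInjective
  obtain ⟨C, T, hT, hinj⟩ := hS.exists_quotient_injective hj
  have hT' : T ≠ ⊤ := hS.ne_top_of_injective hS' hinj hT
  obtain ⟨s, hs⟩ := h.exists_section hE C.mkQ_surjective hT hT'
  have hEC : IsRelInjective R (E ⧸ C) M := hEinj.of_retraction hs
  have hcoatom : IsCoatom T := h.isCoatom_of_isRelInjective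
    (hE.of_surjective C.mkQ C.mkQ_surjective) hT hT' hEC
  let e : N ≃ₗ[R] E ⧸ C :=
    LinearEquiv.ofBijective _ ⟨hinj, hS.surjective_of_injective hS' hinj hT hcoatom⟩
  exact hEC.of_retraction (s := e.toLinearMap) (r := e.symm.toLinearMap) (by simp)

theorem MonolithicProjective.isCoatom (h : MonolithicProjective R M)
    (hN : IsSubgenerated R M N) (hS : IsMonolith S) (hS' : S ≠ ⊤) : IsCoatom S :=
  h.isCoatom_of_isRelInjective hN hS hS' (h.isRelInjective hN hS hS')

end Injective

section Independence

theorem sSupIndep_insert_of_disjoint {α : Type*} [CompleteLattice α] [IsModularLattice α]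
    {s : Set α} (hs : sSupIndep s) {b : α} (hb : Disjoint b (sSup s)) :
    sSupIndep (insert b s) := by
  rintro a (rfl | ha)
  · refine hb.mono_right (sSup_le_sSup ?_)
    rintro c ⟨rfl | hc, hne⟩
    exacts [absurd rfl hne, hc]
  · have hdisj : Disjoint a (sSup (s \ {a}) ⊔ b) :=
      (hs ha).disjoint_sup_right_of_disjoint_sup_left
        (hb.symm.mono_left (sup_le (le_sSup ha) (sSup_le_sSup Set.sdiff_subset)))
    refine hdisj.mono_right (sSup_le ?_)
    rintro c ⟨rfl | hc, hne⟩
    exacts [le_sup_right, le_sup_of_le_left (le_sSup ⟨hc, hne⟩)]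

theorem exists_maximal_sSupIndep {α : Type*} [CompleteLattice α] [IsCompactlyGenerated α]
    (P : α → Prop) : ∃ s : Set α, Maximal (fun s => sSupIndep s ∧ ∀ a ∈ s, P a) s :=
  zorn_subset _ fun c hc hchain => ⟨⋃₀ c,
    ⟨iSupIndep_sUnion_of_directed hchain.directedOn fun _ ht => (hc ht).1,
      fun a ⟨_, ht, ha⟩ => (hc ht).2 a ha⟩, fun _ => Set.subset_sUnion_of_mem⟩

theorem range_le_iSup_map_subtype_of_isMonolith {R : Type u} [Ring R] {N : Type w}
    [AddCommGroup N] [Module R N] {ι : Type*} {A : ι → Submodule R N} (hA : iSupIndep A)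
    {S : ∀ i, Submodule R (A i)} (hS : ∀ i, IsMonolith (S i)) {X : Type*} [AddCommGroup X]
    [Module R X] [IsSimpleModule R X] {f : X →ₗ[R] N} (hf : LinearMap.range f ≤ ⨆ i, A i) :
    LinearMap.range f ≤ ⨆ i, (S i).map (A i).subtype := by
  classical
  let φ : (Π₀ i, A i) →ₗ[R] N := DFinsupp.lsum ℕ fun i => (A i).subtype
  rw [Submodule.iSup_eq_range_dfinsupp_lsum] at hf
  let e : (Π₀ i, A i) ≃ₗ[R] LinearMap.range φ := .ofInjective φ hA.dfinsupp_lsum_injective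
  let f' : X →ₗ[R] LinearMap.range φ := f.codRestrict _ fun x => hf ⟨x, rfl⟩
  let g : X →ₗ[R] Π₀ i, A i := e.symm.toLinearMap ∘ₗ f'
  have hφg (x : X) : φ (g x) = f x := congrArg Subtype.val (e.apply_symm_apply (f' x))
  have hgS (x : X) (i : ι) : g x i ∈ S i :=
    (hS i).range_le_of_isSimpleModule (DFinsupp.lapply i ∘ₗ g) ⟨x, rfl⟩
  rintro _ ⟨x, rfl⟩
  rw [← hφg, DFinsupp.lsum_apply_apply]
  exact Submodule.dfinsuppSumAddHom_mem _ _ _ fun i _ =>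
    Submodule.mem_iSup_of_mem i ⟨g x i, hgS x i, rfl⟩

end Independence

section Family

variable {R : Type u} [Ring R] [Small.{w} R] {M N : Type w} [AddCommGroup M] [Module R M]
  [AddCommGroup N] [Module R N]

theorem MonolithicProjective.jacobsonOfSubmodule_eq (h : MonolithicProjective R M)
    (hN : IsSubgenerated R M N) {A : Submodule R N} {S : Submodule R A} (hS : IsMonolith S)
    (hS' : S ≠ ⊤) : jacobsonOfSubmodule R N A = S.map A.subtype := by
  rw [jacobsonOfSubmodule,
    hS.jacobson_eq (h.isCoatom (hN.of_injective A.subtype A.injective_subtype) hS hS')]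

theorem MonolithicProjective.jacobson_le_iSup (h : MonolithicProjective R M)
    (hN : IsSubgenerated R M N) {s : Set (Submodule R N)}
    (hs : Maximal (fun s : Set (Submodule R N) => sSupIndep s ∧
      ∀ A ∈ s, ∃ S : Submodule R A, IsMonolith S ∧ S ≠ ⊤) s) :
    Module.jacobson R N ≤ ⨆ A : s, jacobsonOfSubmodule R N A := fun x hx => by
  by_contra hxJ
  obtain ⟨C, T, hJC, hT, hT'⟩ := exists_quotient_isMonolith_ne_top hxJ hx
  obtain ⟨σ, hσ⟩ := h.exists_section hN C.mkQ_surjective hT hT'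
  have hσinj : Function.Injective σ := LinearMap.injective_of_comp_eq_id _ _ hσ
  have hdisj : Disjoint (LinearMap.range σ) (sSup s) := by
    by_contra hnd
    choose S hS hS' using fun A : s => hs.1.2 A A.2
    have := hT.isSimpleModule
    have hle : LinearMap.range (σ ∘ₗ T.subtype) ≤ ⨆ A : s, (A : Submodule R N) := by
      rw [LinearMap.range_comp, T.range_subtype, ← sSup_eq_iSup']
      exact hT.map_le_of_not_disjoint hnd
    have hsocle := range_le_iSup_map_subtype_of_isMonolith ((sSupIndep_iff s).1 hs.1.1) hS hle
    simp only [← fun A : s => h.jacobsonOfSubmodule_eq hN (hS A) (hS' A)] at hsocle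
    refine hT.1 ((Submodule.eq_bot_iff T).2 fun y hy => ?_)
    have hyC : C.mkQ (σ y) = 0 :=
      (Submodule.Quotient.mk_eq_zero C).2 (hJC (hsocle ⟨⟨y, hy⟩, rfl⟩))
    exact (LinearMap.congr_fun hσ y).symm.trans hyC
  let e := LinearEquiv.ofInjective σ hσinj
  have hmem : LinearMap.range σ ∈ s := by
    refine hs.mem_of_prop_insert ⟨sSupIndep_insert_of_disjoint hs.1.1 hdisj, ?_⟩
    rintro A (rfl | hA)
    · exact ⟨_, hT.map_equiv e, fun h0 => hT' (by simpa using h0)⟩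
    · exact hs.1.2 A hA
  exact hT.range_ne_bot_of_injective hσinj (disjoint_self.1 (hdisj.mono_right (le_sSup hmem)))

theorem MonolithicProjective.isVModule_quotient_jacobson (h : MonolithicProjective R M)
    (hN : IsSubgenerated R M N) : IsVModule R (N ⧸ Module.jacobson R N) := by
  by_contra hV
  obtain ⟨C, T, hT, hT'⟩ := exists_quotient_of_not_isVModule hV
  let p := C.mkQ ∘ₗ (Module.jacobson R N).mkQ
  have hp : Function.Surjective p := C.mkQ_surjective.comp (Submodule.mkQ_surjective _)
  obtain ⟨σ, hσ⟩ := h.exists_section hN hp hT hT'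
  have hJT := hT.jacobson_eq (h.isCoatom (hN.of_surjective p hp) hT hT')
  refine hT.1 ((Submodule.eq_bot_iff T).2 fun y hy => ?_)
  have hσy : (Module.jacobson R N).mkQ (σ y) = 0 :=
    (Submodule.Quotient.mk_eq_zero _).2 (Module.map_jacobson_le σ ⟨y, hJT ▸ hy, rfl⟩)
  have hpσ : p (σ y) = y := LinearMap.congr_fun hσ y
  rw [← hpσ, LinearMap.comp_apply, hσy, map_zero]

theorem MonolithicProjective.exists_family (h : MonolithicProjective R M) :
    ∃ (I : Type w) (A : I → Submodule R M), iSupIndep A ∧ (∀ i, IsLocalMod R (A i)) ∧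
      (∀ i, IsRelInjective R (A i) M ∧ IsRelProjective R (A i) M ∧ Module.length R (A i) = 2) ∧
      (iSupIndep (fun i => jacobsonOfSubmodule R M (A i)) ∧
        Module.jacobson R M = ⨆ i, jacobsonOfSubmodule R M (A i)) ∧
      IsVModule R (M ⧸ Module.jacobson R M) := by
  have hM := IsSubgenerated.refl R M
  obtain ⟨s, hs⟩ := exists_maximal_sSupIndep fun A : Submodule R M =>
    ∃ S : Submodule R A, IsMonolith S ∧ S ≠ ⊤
  have hA (A : s) : IsSubgenerated R M A := hM.of_injective _ (A : Submodule R M).injective_subtype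
  choose S hS hS' using fun A : s => hs.1.2 A A.2
  have hcoatom (A : s) : IsCoatom (S A) := h.isCoatom (hA A) (hS A) (hS' A)
  have hind : iSupIndep ((↑) : s → Submodule R M) := (sSupIndep_iff s).1 hs.1.1
  exact ⟨s, (↑), hind, fun A => (hS A).isLocalMod (hcoatom A),
    fun A => ⟨h.isRelInjective (hA A) (hS A) (hS' A),
      (h A (hA A) (S A) (hS A) (hS' A)).isRelProjective, (hS A).length_eq_two (hcoatom A)⟩,
    ⟨hind.mono fun A => Submodule.map_subtype_le _ _,
      le_antisymm (h.jacobson_le_iSup hM hs) (iSup_le fun A => Module.map_jacobson_le _)⟩,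
    h.isVModule_quotient_jacobson hM⟩

end Family

section Converse

variable {R : Type u} [Ring R] {M N E X : Type w} [AddCommGroup M] [Module R M]
  [AddCommGroup N] [Module R N] [AddCommGroup E] [Module R E] [AddCommGroup X] [Module R X]

theorem IsVModule.of_forall_le_ker_comp_lsingle {L : Submodule R M} (h : IsVModule R (M ⧸ L))
    {Λ : Type*} {p : (Λ →₀ M) →ₗ[R] N} (hp : Function.Surjective p)
    (hL : ∀ l, L ≤ LinearMap.ker (p ∘ₗ Finsupp.lsingle l)) : IsVModule R N := by
  refine .of_iSup_range_eq_top (fun _ => h) (f := fun l => L.liftQ _ (hL l)) ?_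
  simp only [Submodule.range_liftQ, LinearMap.range_comp]
  rw [← Submodule.map_iSup, Finsupp.iSup_lsingle_range, Submodule.map_top,
    LinearMap.range_eq_top.2 hp]

theorem iSup_jacobsonOfSubmodule_le_ker {ι : Type*} {A : ι → Submodule R M}
    {K : ∀ i, Submodule R (A i)} (hK : ∀ i, IsMonolith (K i)) (hK' : ∀ i, IsCoatom (K i))
    {Y : Type*} [AddCommGroup Y] [Module R Y] {f : M →ₗ[R] Y}
    (hf : ∀ i, ¬ Function.Injective (f ∘ₗ (A i).subtype)) :
    ⨆ i, jacobsonOfSubmodule R M (A i) ≤ LinearMap.ker f := by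
  refine iSup_le fun i => Submodule.map_le_iff_le_comap.2 ?_
  rw [(hK i).jacobson_eq (hK' i), ← LinearMap.ker_comp]
  exact (hK i).le_ker_of_not_injective (hf i)

theorem IsMonolith.isProjectiveInSigma_of_injective {S : Submodule R N} (hS : IsMonolith S)
    (hS' : S ≠ ⊤) {T : Submodule R E} (hT : IsMonolith T) (hE : IsSubgenerated R M E)
    {j : N →ₗ[R] E} (hj : Function.Injective j) {K : Submodule R X} (hK : IsMonolith K)
    (hK' : IsCoatom K) (hX : IsRelInjective R X M) (hXP : IsProjectiveInSigma R M X)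
    {a : X →ₗ[R] E} (ha : Function.Injective a) : IsProjectiveInSigma R M N := by
  obtain ⟨r, hr⟩ := (hX.of_isSubgenerated hE).exists_comp_eq ha LinearMap.id
  have := hK.nontrivial
  have hrinj : Function.Injective r := LinearMap.injective_of_comp_eq_id r a (hT.comp_eq_id hr)
  have hrj : Function.Injective (r ∘ₗ j) := hrinj.comp hj
  exact hXP.of_equiv
    (LinearEquiv.ofBijective _ ⟨hrj, hS.surjective_of_injective hS' hrj hK hK'⟩).symm

theorem IsProjectiveInSigma.of_length_eq_two (hN : IsSubgenerated R M N)
    (h : IsRelProjective R N M) (hlen : Module.length R N = 2) : IsProjectiveInSigma R M N := by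
  have hfin : IsFiniteLength R N :=
    Module.length_ne_top_iff.1 (hlen.trans_ne (ENat.ofNat_ne_top 2))
  have : IsNoetherian R N := (isFiniteLength_iff_isNoetherian_isArtinian.1 hfin).1
  exact .of_isRelProjective hN h

theorem monolithicProjective_of_family {ι : Type*} {A : ι → Submodule R M}
    (hloc : ∀ i, IsLocalMod R (A i))
    (hA : ∀ i, IsRelInjective R (A i) M ∧ IsRelProjective R (A i) M ∧ Module.length R (A i) = 2)
    (hJ : Module.jacobson R M = ⨆ i, jacobsonOfSubmodule R M (A i))
    (hV : IsVModule R (M ⧸ Module.jacobson R M)) : MonolithicProjective R M := by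
  rintro N _ _ ⟨Λ, L, j, hj⟩ S hS hS'
  obtain ⟨C, T, hT, hinj⟩ := hS.exists_quotient_injective hj
  let p := C.mkQ ∘ₗ L.mkQ
  have hp : Function.Surjective p := C.mkQ_surjective.comp L.mkQ_surjective
  choose K hK hK' using fun i => (hloc i).exists_isMonolith_isCoatom (hA i).2.2
  by_cases hex : ∃ l i, Function.Injective ((p ∘ₗ Finsupp.lsingle l) ∘ₗ (A i).subtype)
  · obtain ⟨l, i, ha⟩ := hex
    have hAi : IsSubgenerated R M (A i) :=
      (IsSubgenerated.refl R M).of_injective _ (A i).injective_subtype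
    exact hS.isProjectiveInSigma_of_injective hS' hT
      (.of_surjective_of_injective p hp LinearMap.id Function.injective_id) hinj (hK i) (hK' i)
      (hA i).1 (.of_length_eq_two hAi (hA i).2.1 (hA i).2.2) ha
  · push Not at hex
    have hVquot : IsVModule R (((Λ →₀ M) ⧸ L) ⧸ C) := hV.of_forall_le_ker_comp_lsingle hp
      fun l => hJ.trans_le (iSup_jacobsonOfSubmodule_le_ker hK hK' (hex l))
    exact absurd (hT.eq_top_of_isVModule hVquot) (hS.ne_top_of_injective hS' hinj hT)

end Converse

theorem theorem2p1 (R : Type u) [Ring R] (M : Type (max u v)) [AddCommGroup M] [Module R M] :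
    List.TFAE [
      IsAlmostVModule R M,
      ∀ (N : Type (max u v)) [AddCommGroup N] [Module R N], IsSubgenerated R M N →
        IsVModule R N ∨
        ∃ D C : Submodule R N, IsCompl D C ∧ D ≠ ⊥ ∧ IsProjectiveInSigma R M D,
      ∃ (I : Type (max u v)) (A : I → Submodule R M),
        iSupIndep A ∧
        (∀ i, IsLocalMod R (A i)) ∧
        (∀ i, IsRelInjective R (A i) M ∧ IsRelProjective R (A i) M ∧ Module.length R (A i) = 2) ∧
        (iSupIndep (fun i => jacobsonOfSubmodule R M (A i)) ∧
          Module.jacobson R M = ⨆ i, jacobsonOfSubmodule R M (A i)) ∧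
        IsVModule R (M ⧸ Module.jacobson R M)] := by
  tfae_have 1 → 2 := fun h N _ _ hN =>
    or_iff_not_imp_left.2 (h.monolithicProjective.exists_projective_summand hN)
  tfae_have 2 → 3 := fun h =>
    (monolithicProjective_of_exists_projective_summand h).exists_family
  tfae_have 3 → 1 := fun ⟨_, _, _, hloc, hA, ⟨_, hJ⟩, hV⟩ =>
    (monolithicProjective_of_family hloc hA hJ hV).isAlmostVModule
  tfae_finish
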